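/- Let $n\ge 1$, $s,\tilde s\in\mathbb R$, $0<p<\infty$, $0<q,r\le\infty$, with $1/\infty=0$. For $j\in\mathbb Z$ let $A_j=\{x\in\mathbb R^n: 2^{j-1}\le|x|<2^j\}$. The Herz space $\dot K^s_{q,r}(\mathbb R^n)$ consists of all measurable functions $f$ on $\mathbb R^n$ (real- or complex-valued, identified when equal almost everywhere) with $$\|f\|_{\dot K^s_{q,r}}=\Big(\sum_{j\in\mathbb Z}\big[2^{js}\|f\chi_{A_j}\|_{L^q}\big]^r\Big)^{1/r}<\infty\quad(r<\infty),\qquad \|f\|_{\dot K^s_{q,\infty}}=\sup_{j\in\mathbb Z}2^{js}\|f\chi_{A_j}\|_{L^q}<\infty .$$ For measurable $g$ let $g^*(t)=\inf\{\lambda>0:|\{x\in\mathbb R^n:|g(x)|>\lambda\}|\le t\}$ for $t>0$ (with $\inf\emptyset=\infty$), and $$\|g\|_{L^{p,r}}=\Big(\int_0^\infty\big[t^{1/p}g^*(t)\big]^r\,\frac{dt}{t}\Big)^{1/r}\quad(r<\infty),\qquad \|g\|_{L^{p,\infty}}=\sup_{t>0}t^{1/p}g^*(t).$$ The weighted Lorentz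 space $L^{p,r}_{\tilde s}(\mathbb R^n)$ consists of all measurable $f$ with $\|f\|_{L^{p,r}_{\tilde s}}=\big\||\cdot|^{\tilde s}f\big\|_{L^{p,r}}<\infty$. Suppose that $$\frac sn+\frac1q=\frac{\tilde s}n+\frac1p .$$ 1. If $s<\tilde s$, then $L^{p,r}_{\tilde s}(\mathbb R^n)\hookrightarrow\dot K^s_{q,r}(\mathbb R^n)$: there is a constant $C<\infty$ such that every $f\in L^{p,r}_{\tilde s}(\mathbb R^n)$ belongs to $\dot K^s_{q,r}(\mathbb R^n)$ and satisfies $\|f\|_{\dot K^s_{q,r}}\le C\|f\|_{L^{p,r}_{\tilde s}}$. 2. If $s>\tilde s$, then $\dot K^s_{q,r}(\mathbb R^n)\hookrightarrow L^{p,r}_{\tilde s}(\mathbb R^n)$: there is a constant $C<\infty$ such that every $f\in\dot K^s_{q,r}(\mathbb R^n)$ belongs to $L^{p,r}_{\tilde s}(\mathbb R^n)$ and satisfies $\|f\|_{L^{p,r}_{\tilde s}}\le C\|f\|_{\dot K^s_{q,r}}$. -/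

import Mathlib

open MeasureTheory
open scoped ENNReal NNReal

noncomputable section

namespace HerzLorentz

/-- The dyadic annulus `A_j = {x ∈ ℝⁿ : 2^(j-1) ≤ |x| < 2^j}`. -/
def annulus (n : ℕ) (j : ℤ) : Set (EuclideanSpace ℝ (Fin n)) :=
  {x | (2 : ℝ) ^ (j - 1) ≤ ‖x‖ ∧ ‖x‖ < (2 : ℝ) ^ j}

variable {𝕜 : Type*} [RCLike 𝕜] {n : ℕ}

/-- The quasi-norm of the homogeneous Herz space with smoothness index `s` and exponents `q`, `r`,
with values in `[0, ∞]`. -/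
def herzNorm (s : ℝ) (q r : ℝ≥0∞) (f : EuclideanSpace ℝ (Fin n) → 𝕜) : ℝ≥0∞ :=
  if r = ∞ then
    ⨆ j : ℤ, (2 : ℝ≥0∞) ^ ((j : ℝ) * s) * eLpNorm ((annulus n j).indicator f) q volume
  else
    (∑' j : ℤ, ((2 : ℝ≥0∞) ^ ((j : ℝ) * s) *
      eLpNorm ((annulus n j).indicator f) q volume) ^ r.toReal) ^ (1 / r.toReal)

/-- Membership in the homogeneous Herz space: `f` is (Lebesgue) measurable and its quasi-norm
is finite. -/
def MemHerz (s : ℝ) (q r : ℝ≥0∞) (f : EuclideanSpace ℝ (Fin n) → 𝕜) : Prop :=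
  AEStronglyMeasurable f volume ∧ herzNorm s q r f < ∞

/-- The decreasing rearrangement `f*(t) = inf {λ > 0 : |{x : |f x| > λ}| ≤ t}`, with values in
`[0, ∞]` (the infimum of the empty set is `∞`). -/
def rearrangement (f : EuclideanSpace ℝ (Fin n) → 𝕜) (t : ℝ) : ℝ≥0∞ :=
  sInf {l : ℝ≥0∞ | 0 < l ∧ volume {x | l < ‖f x‖ₑ} ≤ ENNReal.ofReal t}

/-- The quasi-norm of the Lorentz space `L^{p,r}`, with values in `[0, ∞]`. -/
def lorentzNorm (p : ℝ) (r : ℝ≥0∞) (f : EuclideanSpace ℝ (Fin n) → 𝕜) : ℝ≥0∞ :=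
  if r = ∞ then
    ⨆ (t : ℝ) (_ : 0 < t), ENNReal.ofReal t ^ (1 / p) * rearrangement f t
  else
    (∫⁻ t in Set.Ioi (0 : ℝ),
      (ENNReal.ofReal t ^ (1 / p) * rearrangement f t) ^ r.toReal / ENNReal.ofReal t)
        ^ (1 / r.toReal)

/-- The quasi-norm of the Lorentz space with power weight: the Lorentz quasi-norm of `|x|^s f`. -/
def weightedLorentzNorm (s p : ℝ) (r : ℝ≥0∞) (f : EuclideanSpace ℝ (Fin n) → 𝕜) : ℝ≥0∞ :=
  lorentzNorm p r (fun x => ((‖x‖ ^ s : ℝ) : 𝕜) * f x)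

/-- Membership in the Lorentz space with power weight: `f` is (Lebesgue) measurable and its
quasi-norm is finite. -/
def MemWeightedLorentz (s p : ℝ) (r : ℝ≥0∞) (f : EuclideanSpace ℝ (Fin n) → 𝕜) : Prop :=
  AEStronglyMeasurable f volume ∧ weightedLorentzNorm s p r f < ∞

end HerzLorentz

end

/-
A power weight is comparable to a constant on each dyadic annulus, so for the Herz quasi-norm it
only shifts the smoothness index, and the claim reduces to the unweighted case, in which
`s = n (1 / p - 1 / q)`. The Lorentz quasi-norm is comparable to the `ℓ^r` norm of
`T_j ^ (1 / p) * g* (T_j)`, with `T_j` the volume of the ball of radius `2 ^ j`. For `s < 0` the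
integral of `|g| ^ q` over the `j`-th annulus is estimated by slicing it at the heights
`g* (T_{j - m})`, `m ≥ 0`; for `s > 0` the value `g* (T_i)` is bounded by Chebyshev's inequality on
the annuli outside the ball of radius `2 ^ (i - 1)`. Both estimates are convolutions with a
geometric kernel, hence bounded on `ℓ^r`.
-/

namespace HerzLorentz

open Filter Topology

section Sequences

variable {ι : Type*} [MeasurableSpace ι] [MeasurableSingletonClass ι]

theorem eLpNorm_count_top (a : ι → ℝ≥0∞) : eLpNorm a ∞ .count = ⨆ j, a j := by
  simp only [eLpNorm_exponent_top, eLpNormEssSup_count, enorm_eq_self]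

theorem eLpNorm_count_eq_tsum {r : ℝ≥0∞} (hr : r ≠ 0) (hr' : r ≠ ∞) (a : ι → ℝ≥0∞) :
    eLpNorm a r .count = (∑' j, a j ^ r.toReal) ^ (1 / r.toReal) := by
  simp only [eLpNorm_eq_lintegral_rpow_enorm_toReal hr hr', lintegral_count, enorm_eq_self]

theorem eLpNorm_count_le_mul [Countable ι] {a b : ι → ℝ≥0∞} {C : ℝ≥0∞}
    (h : ∀ j, a j ≤ C * b j) (r : ℝ≥0∞) : eLpNorm a r .count ≤ C * eLpNorm b r .count :=
  eLpNorm_le_mul_eLpNorm_of_ae_le_mul'' r (measurable_of_countable b).aestronglyMeasurable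
    (ae_of_all _ h)

theorem tsum_mul_rpow_rpow_le {κ : Type*} {q : ℝ} (hq : 0 < q) (u v : κ → ℝ≥0∞) :
    (∑' m, (u m * v m) ^ q) ^ (1 / q) ≤ (∑' m, u m ^ q) ^ (1 / q) * ⨆ m, v m := by
  rw [← ENNReal.rpow_rpow_inv hq.ne' (⨆ m, v m), ← one_div,
    ← ENNReal.mul_rpow_of_nonneg _ _ (by positivity), ← ENNReal.tsum_mul_right]
  gcongr with m
  rw [← ENNReal.mul_rpow_of_nonneg _ _ hq.le]
  gcongr
  exact le_iSup v m

theorem mul_tsum_rpow_rpow {κ : Type*} {q : ℝ} (hq : 0 < q) (a : ℝ≥0∞) (u : κ → ℝ≥0∞) :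
    a * (∑' m, u m ^ q) ^ (1 / q) = (∑' m, (a * u m) ^ q) ^ (1 / q) := by
  simp only [ENNReal.mul_rpow_of_nonneg _ _ hq.le, ENNReal.tsum_mul_left]
  rw [ENNReal.mul_rpow_of_nonneg _ _ (by positivity), one_div, ENNReal.rpow_rpow_inv hq.ne']

theorem tsum_pow_rpow_ne_top {ρ : ℝ≥0∞} (hρ : ρ < 1) {q : ℝ} (hq : 0 < q) :
    (∑' m : ℕ, (ρ ^ m) ^ q) ^ (1 / q) ≠ ∞ := by
  have hρq : ρ ^ q < 1 := ENNReal.rpow_lt_one hρ hq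
  refine ENNReal.rpow_ne_top_of_nonneg (by positivity) ?_
  simp_rw [← ENNReal.rpow_natCast_mul, mul_comm _ q, ENNReal.rpow_mul_natCast,
    ENNReal.tsum_geometric]
  simpa [tsub_eq_zero_iff_le] using hρq

/-- The supremum is bounded by the `ℓ^r` sum over `m`, which commutes with the sum over `j`. -/
theorem exists_eLpNorm_iSup_pow_mul_le {r : ℝ≥0∞} (hr : r ≠ 0) {ρ : ℝ≥0∞} (hρ : ρ < 1)
    (σ : ℕ → ι ≃ ι) : ∃ C : ℝ≥0, ∀ a : ι → ℝ≥0∞,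
      eLpNorm (fun j => ⨆ m : ℕ, ρ ^ m * a (σ m j)) r .count ≤ C * eLpNorm a r .count := by
  rcases eq_or_ne r ∞ with rfl | hr'
  · refine ⟨1, fun a => ?_⟩
    simp only [eLpNorm_count_top, ENNReal.coe_one, one_mul]
    exact iSup₂_le fun j m => (mul_le_of_le_one_left' (pow_le_one' hρ.le m)).trans (le_iSup a _)
  have hr₀ : 0 < r.toReal := ENNReal.toReal_pos hr hr'
  lift (∑' m : ℕ, (ρ ^ m) ^ r.toReal) ^ (1 / r.toReal) to ℝ≥0
    using tsum_pow_rpow_ne_top hρ hr₀ with C hC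
  refine ⟨C, fun a => ?_⟩
  rw [hC, eLpNorm_count_eq_tsum hr hr', eLpNorm_count_eq_tsum hr hr',
    ← ENNReal.mul_rpow_of_nonneg _ _ (by positivity)]
  gcongr
  calc ∑' j, (⨆ m : ℕ, ρ ^ m * a (σ m j)) ^ r.toReal
      ≤ ∑' j, ∑' m : ℕ, (ρ ^ m * a (σ m j)) ^ r.toReal := by
        gcongr with j
        rw [← ENNReal.le_rpow_inv_iff hr₀]
        refine iSup_le fun m => (ENNReal.le_rpow_inv_iff hr₀).2 ?_
        exact ENNReal.le_tsum (f := fun m => (ρ ^ m * a (σ m j)) ^ r.toReal) m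
    _ = ∑' m : ℕ, ∑' j, (ρ ^ m) ^ r.toReal * a (σ m j) ^ r.toReal := by
        simp only [ENNReal.tsum_comm (α := ι), ENNReal.mul_rpow_of_nonneg _ _ hr₀.le]
    _ = (∑' m : ℕ, (ρ ^ m) ^ r.toReal) * ∑' j, a j ^ r.toReal := by
        simp only [ENNReal.tsum_mul_left, ENNReal.tsum_mul_right,
          fun m => (σ m).tsum_eq fun j => a j ^ r.toReal]

/-- Writing `ρ ^ m = θ ^ m * θ ^ m` with `θ = √ρ` and spending one factor on the sum over `m`
reduces the claim to a geometrically damped supremum. -/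
theorem exists_eLpNorm_tsum_pow_mul_le [Countable ι] {q : ℝ} (hq : 0 < q) {r : ℝ≥0∞} (hr : r ≠ 0)
    {ρ : ℝ≥0∞} (hρ : ρ < 1) (σ : ℕ → ι ≃ ι) : ∃ C : ℝ≥0, ∀ a : ι → ℝ≥0∞,
      eLpNorm (fun j => (∑' m : ℕ, (ρ ^ m * a (σ m j)) ^ q) ^ (1 / q)) r .count ≤
        C * eLpNorm a r .count := by
  obtain ⟨θ, hθ, hθρ⟩ : ∃ θ : ℝ≥0∞, θ < 1 ∧ θ * θ = ρ :=
    ⟨ρ ^ (1 / 2 : ℝ), ENNReal.rpow_lt_one hρ (by norm_num), by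
      rw [← ENNReal.rpow_add_of_nonneg _ _ (by norm_num) (by norm_num)]; norm_num⟩
  obtain ⟨C, hC⟩ := exists_eLpNorm_iSup_pow_mul_le hr hθ σ
  lift (∑' m : ℕ, (θ ^ m) ^ q) ^ (1 / q) to ℝ≥0 using tsum_pow_rpow_ne_top hθ hq with D hD
  refine ⟨D * C, fun a => ?_⟩
  rw [ENNReal.coe_mul, mul_assoc]
  refine (eLpNorm_count_le_mul (fun j => ?_) r).trans (mul_le_mul_right (hC a) D)
  rw [hD]
  simpa only [← hθρ, mul_pow, mul_assoc] using
    tsum_mul_rpow_rpow_le hq (fun m => θ ^ m) fun m => θ ^ m * a (σ m j)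

end Sequences

section Measure

variable {α : Type*} [MeasurableSpace α] {μ : Measure α}

/-- Split `A` into `{u ≤ l 0}`, the layers `{l m < u ≤ l (m + 1)}`, and a null set. -/
theorem setLIntegral_le_add_tsum {u : α → ℝ≥0∞} {A : Set α} {l c : ℕ → ℝ≥0∞}
    (hA : μ A ≤ c 0) (hlc : ∀ m, μ {x | l m < u x} ≤ c m) (hc : Tendsto c atTop (𝓝 0)) :
    ∫⁻ x in A, u x ∂μ ≤ l 0 * c 0 + ∑' m, l (m + 1) * c m := by
  have hle {S : Set α} {b : ℝ≥0∞} (hS : ∀ x ∈ S, u x ≤ b) : ∫⁻ x in S, u x ∂μ ≤ b * μ S :=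
    (setLIntegral_mono measurable_const hS).trans_eq (setLIntegral_const S b)
  have hnull : μ {x | ∀ m, l m < u x} = 0 :=
    le_antisymm (ge_of_tendsto' hc fun m =>
      (measure_mono fun x (hx : ∀ m, l m < u x) => hx m).trans (hlc m)) zero_le
  have hcover : A ⊆ (A ∩ {x | u x ≤ l 0} ∪ ⋃ m, {x | l m < u x ∧ u x ≤ l (m + 1)}) ∪
      {x | ∀ m, l m < u x} := by
    intro x hx
    by_contra! h
    simp only [Set.mem_union, Set.mem_inter_iff, Set.mem_iUnion, Set.mem_ofPred_eq, not_or,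
      not_and, not_exists, not_le] at h
    exact h.2 fun m => Nat.rec (h.1.1 hx) (fun m hm => h.1.2 m hm) m
  calc ∫⁻ x in A, u x ∂μ
      ≤ ∫⁻ x in A ∩ {x | u x ≤ l 0}, u x ∂μ +
          ∑' m, ∫⁻ x in {x | l m < u x ∧ u x ≤ l (m + 1)}, u x ∂μ := by
        refine (lintegral_mono_set hcover).trans ((lintegral_union_le _ _ _).trans ?_)
        rw [setLIntegral_measure_zero _ _ hnull, add_zero]
        exact (lintegral_union_le _ _ _).trans (add_le_add_right (lintegral_iUnion_le _ _) _)
    _ ≤ l 0 * c 0 + ∑' m, l (m + 1) * c m := by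
        gcongr with m
        · exact (hle fun x hx => hx.2).trans
            (mul_le_mul_right ((measure_mono Set.inter_subset_left).trans hA) _)
        · exact (hle fun x hx => hx.2).trans
            (mul_le_mul_right ((measure_mono fun x hx => hx.1).trans (hlc m)) _)

theorem measure_lt_enorm_le_of_eLpNorm_le {E : Type*} [NormedAddCommGroup E] {f : α → E}
    (hf : AEStronglyMeasurable f μ) {q : ℝ≥0∞} (hq : q ≠ 0) {l t : ℝ≥0∞}
    (h : eLpNorm f q μ ≤ t ^ (q⁻¹).toReal * l) : μ {x | l < ‖f x‖ₑ} ≤ t := by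
  rcases eq_or_ne q ∞ with rfl | hq'
  · simp only [ENNReal.inv_top, ENNReal.toReal_zero, ENNReal.rpow_zero, one_mul,
      eLpNorm_exponent_top] at h
    refine (measure_mono_null (fun x hx => ?_)
      (ae_iff.1 (enorm_ae_le_eLpNormEssSup f μ))).trans_le zero_le
    exact not_le.2 (h.trans_lt hx)
  rcases eq_or_ne l 0 with rfl | hl
  · rw [mul_zero, nonpos_iff_eq_zero, eLpNorm_eq_zero_iff hf hq] at h
    refine (measure_mono_null (fun x hx => ?_) (ae_iff.1 h)).trans_le zero_le
    exact enorm_pos.1 hx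
  rcases eq_or_ne l ∞ with rfl | hl'
  · simp
  have hq₀ : 0 < q.toReal := ENNReal.toReal_pos hq hq'
  have hlq : l ^ q.toReal * μ {x | l < ‖f x‖ₑ} ≤ l ^ q.toReal * t := calc
    l ^ q.toReal * μ {x | l < ‖f x‖ₑ} ≤ l ^ q.toReal * μ {x | l ≤ ‖f x‖ₑ} := by
      gcongr with x; exact le_of_lt
    _ ≤ (t ^ (q⁻¹).toReal * l) ^ q.toReal :=
      (mul_meas_ge_le_pow_eLpNorm' μ hq hq' hf l).trans (by gcongr)
    _ = l ^ q.toReal * t := by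
      rw [ENNReal.mul_rpow_of_nonneg _ _ hq₀.le, ENNReal.toReal_inv,
        ENNReal.rpow_inv_rpow hq₀.ne', mul_comm]
  rwa [ENNReal.mul_le_mul_iff_right (by simp [hl, hl'])
    (ENNReal.rpow_ne_top_of_nonneg hq₀.le hl')] at hlq

end Measure

section LogNorm

/-- The `L^r` quasi-norm with respect to `dt / t` on `(0, ∞)`, read as a pointwise supremum when
`r = ∞`; the Lorentz quasi-norm is of this form. -/
noncomputable def logNorm (r : ℝ≥0∞) (h : ℝ → ℝ≥0∞) : ℝ≥0∞ :=
  if r = ∞ then ⨆ (t : ℝ) (_ : 0 < t), h t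
  else (∫⁻ t in Set.Ioi (0 : ℝ), h t ^ r.toReal / ENNReal.ofReal t) ^ (1 / r.toReal)

variable {D b : ℝ}

theorem iUnion_Ioc_mul_zpow (hD : 0 < D) (hb : 1 < b) :
    ⋃ j : ℤ, Set.Ioc (D * b ^ (j - 1)) (D * b ^ j) = Set.Ioi 0 := by
  have : 0 < b := one_pos.trans hb
  refine (Set.iUnion_subset fun j t ht => ?_).antisymm fun t (ht : 0 < t) => ?_
  · exact (by positivity : 0 < D * b ^ (j - 1)).trans ht.1
  · obtain ⟨j, hj⟩ := exists_mem_Ioc_zpow (div_pos ht hD) hb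
    rw [Set.mem_Ioc, lt_div_iff₀' hD, div_le_iff₀' hD] at hj
    exact Set.mem_iUnion.2 ⟨j + 1, by simpa using hj⟩

theorem pairwise_disjoint_Ioc_mul_zpow (hD : 0 < D) (hb : 1 < b) :
    Pairwise (Function.onFun Disjoint fun j : ℤ => Set.Ioc (D * b ^ (j - 1)) (D * b ^ j)) :=
  ((zpow_right_mono₀ hb.le).const_mul hD.le).pairwise_disjoint_on_Ioc_pred

theorem lintegral_Ioc_mul_zpow_inv (hD : 0 < D) (hb : 1 < b) (j : ℤ) :
    ∫⁻ t in Set.Ioc (D * b ^ (j - 1)) (D * b ^ j), (ENNReal.ofReal t)⁻¹ =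
      ENNReal.ofReal (Real.log b) := by
  have hb₀ : 0 < b := one_pos.trans hb
  have hpos (i : ℤ) : 0 < D * b ^ i := by positivity
  have hle : D * b ^ (j - 1) ≤ D * b ^ j := by gcongr <;> linarith
  have hint : IntervalIntegrable (fun t : ℝ => t⁻¹) volume (D * b ^ (j - 1)) (D * b ^ j) :=
    intervalIntegrable_inv_iff.2 (.inr (Set.notMem_uIcc_of_lt (hpos _) (hpos _)))
  calc ∫⁻ t in Set.Ioc (D * b ^ (j - 1)) (D * b ^ j), (ENNReal.ofReal t)⁻¹
      = ∫⁻ t in Set.Ioc (D * b ^ (j - 1)) (D * b ^ j), ENNReal.ofReal t⁻¹ :=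
        setLIntegral_congr_fun measurableSet_Ioc fun t ht =>
          (ENNReal.ofReal_inv_of_pos ((hpos _).trans ht.1)).symm
    _ = ENNReal.ofReal (∫ t in D * b ^ (j - 1)..D * b ^ j, t⁻¹) := by
        rw [intervalIntegral.integral_of_le hle, ofReal_integral_eq_lintegral_ofReal
          ((intervalIntegrable_iff_integrableOn_Ioc_of_le hle).1 hint)]
        exact (ae_restrict_iff' measurableSet_Ioc).2
          (ae_of_all _ fun t ht => inv_nonneg.2 ((hpos _).trans ht.1).le)
    _ = ENNReal.ofReal (Real.log b) := by
        rw [integral_inv_of_pos (hpos _) (hpos _), mul_div_mul_left _ _ hD.ne',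
          ← zpow_sub₀ hb₀.ne', sub_sub_cancel, zpow_one]

theorem lintegral_Ioi_eq_tsum (hD : 0 < D) (hb : 1 < b) (h : ℝ → ℝ≥0∞) :
    ∫⁻ t in Set.Ioi 0, h t = ∑' j : ℤ, ∫⁻ t in Set.Ioc (D * b ^ (j - 1)) (D * b ^ j), h t := by
  rw [← iUnion_Ioc_mul_zpow hD hb, lintegral_iUnion (fun _ => measurableSet_Ioc)
    (pairwise_disjoint_Ioc_mul_zpow hD hb)]

theorem logNorm_le_eLpNorm (hD : 0 < D) (hb : 1 < b) {r : ℝ≥0∞} (hr : r ≠ 0) {h : ℝ → ℝ≥0∞}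
    {c : ℤ → ℝ≥0∞} (hc : ∀ j, ∀ t ∈ Set.Ioc (D * b ^ (j - 1)) (D * b ^ j), h t ≤ c j) :
    logNorm r h ≤ ENNReal.ofReal (Real.log b) ^ (1 / r.toReal) * eLpNorm c r .count := by
  rcases eq_or_ne r ∞ with rfl | hr'
  · simp only [logNorm, if_true, eLpNorm_count_top, ENNReal.toReal_top, div_zero,
      ENNReal.rpow_zero, one_mul]
    refine iSup₂_le fun t ht => ?_
    obtain ⟨j, hj⟩ := Set.mem_iUnion.1 ((iUnion_Ioc_mul_zpow hD hb).ge ht)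
    exact (hc j t hj).trans (le_iSup c j)
  rw [logNorm, if_neg hr', eLpNorm_count_eq_tsum hr hr',
    ← ENNReal.mul_rpow_of_nonneg _ _ (by positivity), lintegral_Ioi_eq_tsum hD hb,
    ← ENNReal.tsum_mul_left]
  gcongr with j
  rw [← lintegral_Ioc_mul_zpow_inv hD hb j, ← lintegral_mul_const _ (by fun_prop)]
  refine setLIntegral_mono (by fun_prop) fun t ht => ?_
  rw [div_eq_mul_inv, mul_comm]
  gcongr
  exact hc j t ht

theorem eLpNorm_le_logNorm (hD : 0 < D) (hb : 1 < b) {r : ℝ≥0∞} (hr : r ≠ 0) {h : ℝ → ℝ≥0∞}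
    {c : ℤ → ℝ≥0∞} (hc : ∀ j, ∀ t ∈ Set.Ioc (D * b ^ (j - 1)) (D * b ^ j), c j ≤ h t) :
    ENNReal.ofReal (Real.log b) ^ (1 / r.toReal) * eLpNorm c r .count ≤ logNorm r h := by
  have : 0 < b := one_pos.trans hb
  rcases eq_or_ne r ∞ with rfl | hr'
  · simp only [logNorm, if_true, eLpNorm_count_top, ENNReal.toReal_top, div_zero,
      ENNReal.rpow_zero, one_mul]
    refine iSup_le fun j => (hc j _ (Set.right_mem_Ioc.2 ?_)).trans
      (le_iSup₂_of_le (D * b ^ j) (by positivity) le_rfl)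
    gcongr; linarith
  rw [logNorm, if_neg hr', eLpNorm_count_eq_tsum hr hr',
    ← ENNReal.mul_rpow_of_nonneg _ _ (by positivity), lintegral_Ioi_eq_tsum hD hb,
    ← ENNReal.tsum_mul_left]
  gcongr with j
  rw [← lintegral_Ioc_mul_zpow_inv hD hb j, ← lintegral_mul_const _ (by fun_prop)]
  refine setLIntegral_mono' measurableSet_Ioc fun t ht => ?_
  rw [div_eq_mul_inv, mul_comm]
  gcongr
  exact hc j t ht

end LogNorm

variable {𝕜 : Type*} [RCLike 𝕜] {n : ℕ}

section Rearrangement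

variable {g : EuclideanSpace ℝ (Fin n) → 𝕜}

/-- The distribution function is right-continuous, so the infimum defining `g*` is attained. -/
theorem rearrangement_le_iff {t : ℝ} {l : ℝ≥0∞} :
    rearrangement g t ≤ l ↔ volume {x | l < ‖g x‖ₑ} ≤ ENNReal.ofReal t := by
  refine ⟨fun h => ?_, fun h => le_of_forall_gt_imp_ge_of_dense fun a ha => sInf_le
    ⟨zero_le.trans_lt ha, (measure_mono fun x hx => ha.trans hx).trans h⟩⟩
  rcases eq_or_ne l ∞ with rfl | hl
  · simp
  obtain ⟨u, hu_anti, hu, hu_lim⟩ := exists_seq_strictAnti_tendsto' hl.lt_top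
  have hunion : {x | l < ‖g x‖ₑ} = ⋃ m, {x | u m < ‖g x‖ₑ} := by
    ext x
    simp only [Set.mem_iUnion, Set.mem_ofPred_eq]
    exact ⟨fun hx => (hu_lim.eventually_lt_const hx).exists, fun ⟨m, hm⟩ => (hu m).1.trans hm⟩
  have hmono : Monotone fun m => {x | u m < ‖g x‖ₑ} := fun i j hij x hx =>
    (hu_anti.antitone hij).trans_lt hx
  rw [hunion, hmono.measure_iUnion]
  refine iSup_le fun m => ?_
  obtain ⟨a, ha, ham⟩ := sInf_lt_iff.1 (h.trans_lt (hu m).1)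
  exact (measure_mono fun x hx => ham.trans hx).trans ha.2

theorem volume_rearrangement_lt_enorm_le (g : EuclideanSpace ℝ (Fin n) → 𝕜) (t : ℝ) :
    volume {x | rearrangement g t < ‖g x‖ₑ} ≤ ENNReal.ofReal t :=
  rearrangement_le_iff.1 le_rfl

theorem rearrangement_antitone (g : EuclideanSpace ℝ (Fin n) → 𝕜) :
    Antitone (rearrangement g) := fun _ _ hst =>
  rearrangement_le_iff.2 ((volume_rearrangement_lt_enorm_le g _).trans (by gcongr))

end Rearrangement

section Discretization

/-- The volume of the ball of radius `2 ^ j` in `ℝⁿ`; these numbers form the geometric mesh on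
which rearrangements are sampled. -/
noncomputable def ballVolume (n : ℕ) (j : ℤ) : ℝ :=
  volume.real (Metric.ball (0 : EuclideanSpace ℝ (Fin n)) (2 ^ j))

theorem ballVolume_pos (n : ℕ) (j : ℤ) : 0 < ballVolume n j :=
  ENNReal.toReal_pos (Metric.measure_ball_pos _ _ (by positivity)).ne' measure_ball_lt_top.ne

theorem ofReal_ballVolume (n : ℕ) (j : ℤ) :
    ENNReal.ofReal (ballVolume n j) =
      volume (Metric.ball (0 : EuclideanSpace ℝ (Fin n)) (2 ^ j)) :=
  ofReal_measureReal measure_ball_lt_top.ne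

theorem ballVolume_eq (n : ℕ) (j : ℤ) : ballVolume n j = ballVolume n 0 * (2 ^ n) ^ j := by
  rw [ballVolume, ballVolume, measureReal_def, measureReal_def,
    Measure.addHaar_ball_of_pos _ _ (by positivity), ENNReal.toReal_mul,
    ENNReal.toReal_ofReal (by positivity), finrank_euclideanSpace_fin, zpow_zero, mul_comm,
    ← zpow_natCast, ← zpow_natCast, ← zpow_mul, ← zpow_mul, mul_comm j]

theorem ballVolume_add_one (n : ℕ) (j : ℤ) : ballVolume n (j + 1) = 2 ^ n * ballVolume n j := by
  rw [ballVolume_eq n (j + 1), ballVolume_eq n j, zpow_add_one₀ (by positivity)]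
  ring

theorem tendsto_ofReal_ballVolume_sub (hn : n ≠ 0) (j : ℤ) :
    Tendsto (fun m : ℕ => ENNReal.ofReal (ballVolume n (j - m))) atTop (𝓝 0) := by
  have hb : (1 : ℝ) < 2 ^ n := one_lt_pow₀ one_lt_two hn
  have heq (m : ℕ) : ballVolume n (j - m) = ballVolume n j * ((2 ^ n)⁻¹) ^ m := by
    rw [ballVolume_eq n (j - m), ballVolume_eq n j, zpow_sub₀ (by positivity), zpow_natCast,
      inv_pow, mul_div_assoc', div_eq_mul_inv]
  have hlim := (tendsto_pow_atTop_nhds_zero_of_lt_one (by positivity)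
    (inv_lt_one_of_one_lt₀ hb)).const_mul (ballVolume n j)
  simpa only [heq, mul_zero, ENNReal.ofReal_zero] using ENNReal.tendsto_ofReal hlim

theorem ofReal_ballVolume_rpow (n : ℕ) (j : ℤ) (x : ℝ) :
    ENNReal.ofReal (ballVolume n j) ^ x =
      ENNReal.ofReal (ballVolume n 0) ^ x * 2 ^ (j * (n * x)) := by
  have hpos := ballVolume_pos n 0
  rw [ballVolume_eq, ENNReal.ofReal_rpow_of_pos (by positivity),
    ENNReal.ofReal_rpow_of_pos hpos, Real.mul_rpow hpos.le (by positivity),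
    ENNReal.ofReal_mul (by positivity), ← ENNReal.ofReal_ofNat 2,
    ENNReal.ofReal_rpow_of_pos two_pos, ← Real.rpow_intCast, ← Real.rpow_natCast,
    ← Real.rpow_mul zero_le_two, ← Real.rpow_mul zero_le_two]
  congr 3
  ring

/-- The `j`-th term of the sequence whose `ℓ^r` norm is the Herz quasi-norm. -/
noncomputable def annulusTerm (s : ℝ) (q : ℝ≥0∞) (g : EuclideanSpace ℝ (Fin n) → 𝕜) (j : ℤ) :
    ℝ≥0∞ :=
  2 ^ ((j : ℝ) * s) * eLpNorm ((annulus n j).indicator g) q volume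

/-- The function `t ^ (1 / p) * g* t` of the Lorentz quasi-norm, sampled at the volume of the ball
of radius `2 ^ j`. -/
noncomputable def meshTerm (p : ℝ) (g : EuclideanSpace ℝ (Fin n) → 𝕜) (j : ℤ) : ℝ≥0∞ :=
  ENNReal.ofReal (ballVolume n j) ^ (1 / p) * rearrangement g (ballVolume n j)

theorem herzNorm_eq_eLpNorm {r : ℝ≥0∞} (hr : r ≠ 0) (s : ℝ) (q : ℝ≥0∞)
    (g : EuclideanSpace ℝ (Fin n) → 𝕜) :
    herzNorm s q r g = eLpNorm (annulusTerm s q g) r .count := by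
  rcases eq_or_ne r ∞ with rfl | hr'
  · simp only [herzNorm, if_true, eLpNorm_count_top, annulusTerm]
  · simp only [herzNorm, if_neg hr', eLpNorm_count_eq_tsum hr hr', annulusTerm]

theorem lorentzNorm_eq_logNorm (p : ℝ) (r : ℝ≥0∞) (g : EuclideanSpace ℝ (Fin n) → 𝕜) :
    lorentzNorm p r g = logNorm r fun t => ENNReal.ofReal t ^ (1 / p) * rearrangement g t :=
  rfl

theorem ofReal_ballVolume_add_one_rpow (n : ℕ) (j : ℤ) {x : ℝ} (hx : 0 ≤ x) :
    ENNReal.ofReal (ballVolume n (j + 1)) ^ x =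
      (2 ^ n) ^ x * ENNReal.ofReal (ballVolume n j) ^ x := by
  rw [ballVolume_add_one, ENNReal.ofReal_mul (by positivity), ENNReal.mul_rpow_of_nonneg _ _ hx,
    ENNReal.ofReal_pow zero_le_two, ENNReal.ofReal_ofNat]

theorem exists_eLpNorm_meshTerm_le_lorentzNorm (hn : n ≠ 0) {p : ℝ} (hp : 0 ≤ p) {r : ℝ≥0∞}
    (hr : r ≠ 0) :
    ∃ C : ℝ≥0, ∀ g : EuclideanSpace ℝ (Fin n) → 𝕜,
      eLpNorm (meshTerm p g) r .count ≤ C * lorentzNorm p r g := by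
  have hp' : 0 ≤ 1 / p := by positivity
  have hb : (1 : ℝ) < 2 ^ n := one_lt_pow₀ one_lt_two hn
  set L : ℝ≥0∞ := ENNReal.ofReal (Real.log (2 ^ n)) ^ (1 / r.toReal)
  have hL : L ≠ 0 :=
    (ENNReal.rpow_pos (ENNReal.ofReal_pos.2 (Real.log_pos hb)) ENNReal.ofReal_ne_top).ne'
  have hL' : L ≠ ∞ := ENNReal.rpow_ne_top_of_nonneg (by positivity) ENNReal.ofReal_ne_top
  lift (2 ^ n : ℝ≥0∞) ^ (1 / p) to ℝ≥0
    using ENNReal.rpow_ne_top_of_nonneg hp' (by finiteness) with B hB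
  refine ⟨B * L⁻¹.toNNReal, fun g => ?_⟩
  rw [ENNReal.coe_mul, ENNReal.coe_toNNReal (ENNReal.inv_ne_top.2 hL), mul_assoc]
  let c (j : ℤ) : ℝ≥0∞ :=
    ENNReal.ofReal (ballVolume n (j - 1)) ^ (1 / p) * rearrangement g (ballVolume n j)
  have hc : L * eLpNorm c r .count ≤ lorentzNorm p r g := by
    refine eLpNorm_le_logNorm (ballVolume_pos n 0) hb hr fun j t ht => ?_
    rw [← ballVolume_eq, ← ballVolume_eq] at ht
    dsimp only [c]
    gcongr
    · exact ht.1.le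
    · exact rearrangement_antitone g ht.2
  calc eLpNorm (meshTerm p g) r .count ≤ B * eLpNorm c r .count := by
        refine eLpNorm_count_le_mul (fun j => ?_) r
        rw [hB, ← mul_assoc, ← ofReal_ballVolume_add_one_rpow n _ hp', sub_add_cancel, meshTerm]
    _ ≤ B * (L⁻¹ * lorentzNorm p r g) := by
        gcongr
        exact (ENNReal.mul_le_iff_le_inv hL hL').1 hc

theorem exists_lorentzNorm_le_eLpNorm_meshTerm (hn : n ≠ 0) {p : ℝ} (hp : 0 ≤ p) {r : ℝ≥0∞}
    (hr : r ≠ 0) :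
    ∃ C : ℝ≥0, ∀ g : EuclideanSpace ℝ (Fin n) → 𝕜,
      lorentzNorm p r g ≤ C * eLpNorm (meshTerm p g) r .count := by
  have hp' : 0 ≤ 1 / p := by positivity
  have hb : (1 : ℝ) < 2 ^ n := one_lt_pow₀ one_lt_two hn
  lift ENNReal.ofReal (Real.log (2 ^ n)) ^ (1 / r.toReal) to ℝ≥0
    using ENNReal.rpow_ne_top_of_nonneg (by positivity) ENNReal.ofReal_ne_top with L hL
  lift (2 ^ n : ℝ≥0∞) ^ (1 / p) to ℝ≥0
    using ENNReal.rpow_ne_top_of_nonneg hp' (by finiteness) with B hB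
  refine ⟨L * B, fun g => ?_⟩
  let c (j : ℤ) : ℝ≥0∞ :=
    ENNReal.ofReal (ballVolume n (j + 1)) ^ (1 / p) * rearrangement g (ballVolume n j)
  calc lorentzNorm p r g ≤ L * eLpNorm c r .count := by
        rw [hL, lorentzNorm_eq_logNorm]
        refine logNorm_le_eLpNorm (D := ballVolume n 1) (ballVolume_pos n 1) hb hr fun j t ht => ?_
        have hD (i : ℤ) : ballVolume n 1 * (2 ^ n) ^ i = ballVolume n (i + 1) := by
          rw [ballVolume_eq n 1, ballVolume_eq n (i + 1), zpow_one, zpow_add_one₀ (by positivity)]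
          ring
        rw [hD, hD, sub_add_cancel] at ht
        dsimp only [c]
        gcongr
        · exact ht.2
        · exact rearrangement_antitone g ht.1.le
    _ ≤ L * (B * eLpNorm (meshTerm p g) r .count) := by
        gcongr
        refine eLpNorm_count_le_mul (fun j => ?_) r
        rw [hB, meshTerm, ← mul_assoc, ← ofReal_ballVolume_add_one_rpow n _ hp']
    _ = (L * B : ℝ≥0) * eLpNorm (meshTerm p g) r .count := by rw [ENNReal.coe_mul, mul_assoc]

end Discretization

section PowerWeight

/-- The product of `f` with the power weight `|x| ^ σ`. -/
noncomputable def powerWeight (σ : ℝ) (f : EuclideanSpace ℝ (Fin n) → 𝕜) :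
    EuclideanSpace ℝ (Fin n) → 𝕜 :=
  fun x => ((‖x‖ ^ σ : ℝ) : 𝕜) * f x

theorem measurableSet_annulus (n : ℕ) (j : ℤ) : MeasurableSet (annulus n j) :=
  (measurableSet_le measurable_const measurable_norm).inter
    (measurableSet_lt measurable_norm measurable_const)

theorem aestronglyMeasurable_powerWeight {f : EuclideanSpace ℝ (Fin n) → 𝕜}
    (hf : AEStronglyMeasurable f volume) (σ : ℝ) :
    AEStronglyMeasurable (powerWeight σ f) volume :=
  (RCLike.measurable_ofReal.comp
    (measurable_norm.pow_const σ)).aestronglyMeasurable.mul hf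

theorem powerWeight_neg_powerWeight (σ : ℝ) (f : EuclideanSpace ℝ (Fin n) → 𝕜)
    {x : EuclideanSpace ℝ (Fin n)} (hx : x ≠ 0) : powerWeight (-σ) (powerWeight σ f) x = f x := by
  rw [powerWeight, powerWeight, ← mul_assoc, ← RCLike.ofReal_mul,
    ← Real.rpow_add (norm_pos_iff.2 hx), neg_add_cancel, Real.rpow_zero, RCLike.ofReal_one, one_mul]

theorem norm_rpow_le_of_mem_annulus {j : ℤ} {x : EuclideanSpace ℝ (Fin n)} (hx : x ∈ annulus n j)
    (σ : ℝ) : ‖x‖ ^ σ ≤ 2 ^ |σ| * 2 ^ (j * σ) := by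
  have hpos : 0 < ‖x‖ := (by positivity : (0 : ℝ) < 2 ^ (j - 1)).trans_le hx.1
  have hj : (2 : ℝ) ^ (j * σ) = (2 ^ j) ^ σ := by
    rw [Real.rpow_mul zero_le_two, Real.rpow_intCast]
  rw [hj]
  rcases le_total 0 σ with hσ | hσ
  · calc ‖x‖ ^ σ ≤ (2 ^ j) ^ σ := by gcongr; exact hx.2.le
      _ ≤ 2 ^ |σ| * (2 ^ j) ^ σ :=
        le_mul_of_one_le_left (by positivity) (Real.one_le_rpow one_le_two (abs_nonneg σ))
  · calc ‖x‖ ^ σ ≤ (2 ^ (j - 1)) ^ σ :=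
        Real.rpow_le_rpow_of_nonpos (by positivity) hx.1 hσ
      _ = 2 ^ |σ| * (2 ^ j) ^ σ := by
        rw [abs_of_nonpos hσ, zpow_sub_one₀ two_ne_zero, Real.mul_rpow (by positivity)
          (by positivity), Real.inv_rpow zero_le_two, Real.rpow_neg zero_le_two, mul_comm]

theorem nnnorm_powerWeight_le {j : ℤ} {x : EuclideanSpace ℝ (Fin n)} (hx : x ∈ annulus n j) (σ : ℝ)
    (f : EuclideanSpace ℝ (Fin n) → 𝕜) :
    ‖powerWeight σ f x‖₊ ≤ (2 : ℝ≥0) ^ |σ| * 2 ^ (j * σ) * ‖f x‖₊ := by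
  rw [powerWeight, nnnorm_mul]
  gcongr
  rw [← NNReal.coe_le_coe, coe_nnnorm, RCLike.norm_ofReal, abs_of_nonneg (by positivity)]
  exact_mod_cast norm_rpow_le_of_mem_annulus hx σ

theorem herzNorm_le_of_nnnorm_le {f g : EuclideanSpace ℝ (Fin n) → 𝕜} {C : ℝ≥0} {σ : ℝ}
    (h : ∀ j, ∀ x ∈ annulus n j, ‖f x‖₊ ≤ C * 2 ^ (j * σ) * ‖g x‖₊) (s : ℝ) (q : ℝ≥0∞) {r : ℝ≥0∞}
    (hr : r ≠ 0) : herzNorm s q r f ≤ C * herzNorm (s + σ) q r g := by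
  rw [herzNorm_eq_eLpNorm hr, herzNorm_eq_eLpNorm hr]
  refine eLpNorm_count_le_mul (fun j => ?_) r
  have hind : eLpNorm ((annulus n j).indicator f) q volume ≤
      (C * 2 ^ (j * σ) : ℝ≥0) * eLpNorm ((annulus n j).indicator g) q volume :=
    eLpNorm_le_nnreal_smul_eLpNorm_of_ae_le_mul (ae_of_all _ fun x => by
      by_cases hx : x ∈ annulus n j
      · simpa only [Set.indicator_of_mem hx] using h j x hx
      · simp only [Set.indicator_of_notMem hx, nnnorm_zero, mul_zero, le_refl]) q
  calc annulusTerm s q f j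
      ≤ 2 ^ (j * s) * (C * 2 ^ (j * σ) * eLpNorm ((annulus n j).indicator g) q volume) := by
        rw [annulusTerm]
        gcongr
        simpa [ENNReal.coe_rpow_of_ne_zero] using hind
    _ = C * annulusTerm (s + σ) q g j := by
        rw [annulusTerm, mul_add, ENNReal.rpow_add _ _ two_ne_zero ENNReal.ofNat_ne_top]
        ring

theorem herzNorm_powerWeight_le (s σ : ℝ) (q : ℝ≥0∞) {r : ℝ≥0∞} (hr : r ≠ 0)
    (f : EuclideanSpace ℝ (Fin n) → 𝕜) :
    herzNorm (s - σ) q r (powerWeight σ f) ≤ (2 ^ |σ| : ℝ≥0) * herzNorm s q r f := by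
  simpa only [sub_add_cancel] using
    herzNorm_le_of_nnnorm_le (fun _ _ hx => nnnorm_powerWeight_le hx σ f) (s - σ) q hr

theorem herzNorm_le_powerWeight (s σ : ℝ) (q : ℝ≥0∞) {r : ℝ≥0∞} (hr : r ≠ 0)
    (f : EuclideanSpace ℝ (Fin n) → 𝕜) :
    herzNorm s q r f ≤ (2 ^ |σ| : ℝ≥0) * herzNorm (s - σ) q r (powerWeight σ f) := by
  refine herzNorm_le_of_nnnorm_le (fun j x hx => ?_) s q hr
  have hx₀ : x ≠ 0 := norm_pos_iff.1 ((by positivity : (0 : ℝ) < 2 ^ (j - 1)).trans_le hx.1)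
  simpa only [powerWeight_neg_powerWeight σ f hx₀, abs_neg] using
    nnnorm_powerWeight_le hx (-σ) (powerWeight σ f)

end PowerWeight

section LorentzToHerz

theorem setLIntegral_annulus_enorm_rpow_le (hn : n ≠ 0) {e : ℝ} (he : 0 < e)
    (g : EuclideanSpace ℝ (Fin n) → 𝕜) (j : ℤ) :
    ∫⁻ x in annulus n j, ‖g x‖ₑ ^ e ≤ 2 ^ n * ∑' m : ℕ,
      (ENNReal.ofReal (ballVolume n (j - m)) ^ (1 / e) *
        rearrangement g (ballVolume n (j - m))) ^ e := by
  let l (m : ℕ) : ℝ≥0∞ := rearrangement g (ballVolume n (j - m)) ^ e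
  let c (m : ℕ) : ℝ≥0∞ := ENNReal.ofReal (ballVolume n (j - m))
  have hc_succ (m : ℕ) : c m = 2 ^ n * c (m + 1) := by
    have hj : j - m = j - (m + 1 : ℕ) + 1 := by push_cast; ring
    simp only [c]
    rw [hj, ballVolume_add_one, ENNReal.ofReal_mul (by positivity),
      ENNReal.ofReal_pow zero_le_two, ENNReal.ofReal_ofNat]
  have hA : volume (annulus n j) ≤ c 0 := by
    simp only [c, Nat.cast_zero, sub_zero, ofReal_ballVolume]
    exact measure_mono fun x hx => mem_ball_zero_iff.2 hx.2
  have hlc (m : ℕ) : volume {x | l m < ‖g x‖ₑ ^ e} ≤ c m := by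
    simpa only [l, ENNReal.rpow_lt_rpow_iff he] using
      volume_rearrangement_lt_enorm_le g (ballVolume n (j - m))
  calc ∫⁻ x in annulus n j, ‖g x‖ₑ ^ e
      ≤ l 0 * c 0 + ∑' m, l (m + 1) * c m :=
        setLIntegral_le_add_tsum hA hlc (tendsto_ofReal_ballVolume_sub hn j)
    _ ≤ 2 ^ n * (l 0 * c 0) + ∑' m, 2 ^ n * (l (m + 1) * c (m + 1)) := by
        refine add_le_add (le_mul_of_one_le_left' (one_le_pow_of_one_le' one_le_two n))
          (ENNReal.tsum_le_tsum fun m => ?_)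
        rw [hc_succ m, mul_left_comm]
    _ = 2 ^ n * ∑' m, l m * c m := by
        rw [ENNReal.tsum_mul_left, ← mul_add,
          tsum_eq_zero_add' (f := fun m => l m * c m) ENNReal.summable]
    _ = _ := by
        simp only [l, c, ENNReal.mul_rpow_of_nonneg _ _ he.le, one_div,
          ENNReal.rpow_inv_rpow he.ne', mul_comm]

theorem two_rpow_mul_ballVolume_rpow_mul_rearrangement {s p e : ℝ} (hs : s = n * (1 / p - 1 / e))
    (g : EuclideanSpace ℝ (Fin n) → 𝕜) (j : ℤ) (m : ℕ) :
    2 ^ (j * s) * (ENNReal.ofReal (ballVolume n (j - m)) ^ (1 / e) *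
        rearrangement g (ballVolume n (j - m))) =
      ENNReal.ofReal (ballVolume n 0) ^ (1 / e - 1 / p) *
        ((2 ^ s) ^ m * meshTerm p g (j - m)) := by
  have hT : ENNReal.ofReal (ballVolume n (j - m)) ≠ 0 :=
    (ENNReal.ofReal_pos.2 (ballVolume_pos n _)).ne'
  have hexp : j * s + (j - m : ℤ) * (n * (1 / e - 1 / p)) = s * m := by
    rw [hs]; push_cast; ring
  have hpow : (2 : ℝ≥0∞) ^ (j * s) * 2 ^ ((j - m : ℤ) * (n * (1 / e - 1 / p))) =
      (2 ^ s) ^ m := by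
    rw [← ENNReal.rpow_add _ _ two_ne_zero ENNReal.ofNat_ne_top, hexp, ENNReal.rpow_mul_natCast]
  rw [meshTerm, ← hpow, ← sub_add_cancel (1 / e) (1 / p),
    ENNReal.rpow_add _ _ hT ENNReal.ofReal_ne_top, sub_add_cancel,
    ofReal_ballVolume_rpow n (j - m) (1 / e - 1 / p)]
  ring

theorem exists_annulusTerm_le (hn : n ≠ 0) {s p : ℝ} {q : ℝ≥0∞} (hq : q ≠ 0)
    (hq' : q ≠ ∞) (hs : s = n * (1 / p - (q⁻¹).toReal)) :
    ∃ C : ℝ≥0, ∀ (g : EuclideanSpace ℝ (Fin n) → 𝕜) (j : ℤ), annulusTerm s q g j ≤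
      C * (∑' m : ℕ, ((2 ^ s) ^ m * meshTerm p g (j - m)) ^ q.toReal) ^ (1 / q.toReal) := by
  have he : 0 < q.toReal := ENNReal.toReal_pos hq hq'
  rw [ENNReal.toReal_inv, ← one_div] at hs
  set e := q.toReal
  have hB : (2 ^ n : ℝ≥0∞) ^ (1 / e) ≠ ∞ :=
    ENNReal.rpow_ne_top_of_nonneg (by positivity) (by finiteness)
  have hκ : ENNReal.ofReal (ballVolume n 0) ^ (1 / e - 1 / p) ≠ ∞ :=
    ENNReal.rpow_ne_top_of_ne_zero (ENNReal.ofReal_pos.2 (ballVolume_pos n 0)).ne'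
      ENNReal.ofReal_ne_top
  refine ⟨((2 ^ n) ^ (1 / e) * ENNReal.ofReal (ballVolume n 0) ^ (1 / e - 1 / p)).toNNReal,
    fun g j => ?_⟩
  rw [ENNReal.coe_toNNReal (ENNReal.mul_ne_top hB hκ)]
  let b (m : ℕ) : ℝ≥0∞ := ENNReal.ofReal (ballVolume n (j - m)) ^ (1 / e) *
    rearrangement g (ballVolume n (j - m))
  calc annulusTerm s q g j
      = 2 ^ (j * s) * (∫⁻ x in annulus n j, ‖g x‖ₑ ^ e) ^ (1 / e) := by
        rw [annulusTerm, eLpNorm_indicator_eq_eLpNorm_restrict (measurableSet_annulus n j),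
          eLpNorm_eq_lintegral_rpow_enorm_toReal hq hq']
    _ ≤ 2 ^ (j * s) * (2 ^ n * ∑' m, b m ^ e) ^ (1 / e) := by
        gcongr
        exact setLIntegral_annulus_enorm_rpow_le hn he g j
    _ = (2 ^ n) ^ (1 / e) * (∑' m, (2 ^ (j * s) * b m) ^ e) ^ (1 / e) := by
        rw [ENNReal.mul_rpow_of_nonneg _ _ (by positivity), ← mul_tsum_rpow_rpow he, mul_left_comm]
    _ = _ := by
        simp only [b, two_rpow_mul_ballVolume_rpow_mul_rearrangement hs, ← mul_tsum_rpow_rpow he,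
          mul_assoc]

theorem exists_herzNorm_le_lorentzNorm (hn : n ≠ 0) {s p : ℝ} (hp : 0 < p) {q r : ℝ≥0∞}
    (hq : q ≠ 0) (hr : r ≠ 0) (hs : s = n * (1 / p - (q⁻¹).toReal)) (hs₀ : s < 0) :
    ∃ C : ℝ≥0, ∀ g : EuclideanSpace ℝ (Fin n) → 𝕜,
      herzNorm s q r g ≤ C * lorentzNorm p r g := by
  have hq' : q ≠ ∞ := by
    rintro rfl
    rw [ENNReal.inv_top, ENNReal.toReal_zero, sub_zero] at hs
    have : 0 ≤ s := hs ▸ by positivity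
    linarith
  have hρ : (2 : ℝ≥0∞) ^ s < 1 := ENNReal.rpow_lt_one_of_one_lt_of_neg ENNReal.one_lt_two hs₀
  obtain ⟨A, hA⟩ := exists_annulusTerm_le (𝕜 := 𝕜) hn hq hq' hs
  obtain ⟨B, hB⟩ := exists_eLpNorm_tsum_pow_mul_le (ENNReal.toReal_pos hq hq') hr hρ
    fun m : ℕ => Equiv.subRight (m : ℤ)
  obtain ⟨C, hC⟩ := exists_eLpNorm_meshTerm_le_lorentzNorm (𝕜 := 𝕜) hn hp.le hr
  refine ⟨A * (B * C), fun g => ?_⟩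
  calc herzNorm s q r g = eLpNorm (annulusTerm s q g) r .count := herzNorm_eq_eLpNorm hr s q g
    _ ≤ A * (B * (C * lorentzNorm p r g)) := (eLpNorm_count_le_mul (hA g) r).trans
        (by gcongr; exact (hB (meshTerm p g)).trans (by gcongr; exact hC g))
    _ = (A * (B * C) : ℝ≥0) * lorentzNorm p r g := by push_cast; ring

end LorentzToHerz

section HerzToLorentz

theorem compl_ball_subset_iUnion_annulus (n : ℕ) (i : ℤ) :
    (Metric.ball 0 (2 ^ (i - 1)))ᶜ ⊆ ⋃ m : ℕ, annulus n (i + m) := by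
  intro x hx
  have hx' : (2 : ℝ) ^ (i - 1) ≤ ‖x‖ := by simpa using hx
  obtain ⟨k, hk⟩ := exists_mem_Ico_zpow ((by positivity : (0 : ℝ) < 2 ^ (i - 1)).trans_le hx')
    one_lt_two
  have hik : i - 1 < k + 1 := (zpow_lt_zpow_iff_right₀ one_lt_two).1 (hx'.trans_lt hk.2)
  obtain ⟨m, hm⟩ := Int.le.dest (show i ≤ k + 1 by lia)
  refine Set.mem_iUnion.2 ⟨m, ?_⟩
  rw [hm]
  exact ⟨by simpa using hk.1, hk.2⟩

/-- Half of the volume `ballVolume n i` pays for a ball of half the radius, the other half for the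
annuli outside it, the `m`-th one getting the share `c m`. -/
theorem rearrangement_ballVolume_le (hn : n ≠ 0) {q : ℝ≥0∞} (hq : q ≠ 0)
    {g : EuclideanSpace ℝ (Fin n) → 𝕜} (hg : AEStronglyMeasurable g volume) {i : ℤ} {l : ℝ≥0∞}
    {c : ℕ → ℝ≥0∞} (hc : ∑' m, c m ≤ 2⁻¹)
    (h : ∀ m : ℕ, eLpNorm ((annulus n (i + m)).indicator g) q volume ≤
      (ENNReal.ofReal (ballVolume n i) * c m) ^ (q⁻¹).toReal * l) :
    rearrangement g (ballVolume n i) ≤ l := by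
  set T := ENNReal.ofReal (ballVolume n i) with hT
  have hball : volume (Metric.ball (0 : EuclideanSpace ℝ (Fin n)) (2 ^ (i - 1))) ≤ T * 2⁻¹ := by
    rw [← ofReal_ballVolume, ← div_eq_mul_inv, ENNReal.le_div_iff_mul_le (by simp) (by simp), hT,
      ← sub_add_cancel i 1, ballVolume_add_one, ENNReal.ofReal_mul (by positivity),
      ENNReal.ofReal_pow zero_le_two, ENNReal.ofReal_ofNat, add_sub_cancel_right, mul_comm]
    gcongr
    exact le_self_pow₀ one_le_two hn
  have hcover : {x | l < ‖g x‖ₑ} ⊆ Metric.ball 0 (2 ^ (i - 1)) ∪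
      ⋃ m : ℕ, {x | l < ‖(annulus n (i + m)).indicator g x‖ₑ} := by
    intro x hx
    by_cases hxb : x ∈ Metric.ball 0 (2 ^ (i - 1))
    · exact .inl hxb
    obtain ⟨m, hm⟩ := Set.mem_iUnion.1 (compl_ball_subset_iUnion_annulus n i hxb)
    exact .inr (Set.mem_iUnion.2 ⟨m, by simpa only [Set.mem_ofPred_eq, Set.indicator_of_mem hm]⟩)
  refine rearrangement_le_iff.2 ?_
  calc volume {x | l < ‖g x‖ₑ}
      ≤ volume (Metric.ball (0 : EuclideanSpace ℝ (Fin n)) (2 ^ (i - 1))) +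
          ∑' m : ℕ, volume {x | l < ‖(annulus n (i + m)).indicator g x‖ₑ} :=
        (measure_mono hcover).trans ((measure_union_le _ _).trans
          (add_le_add_right (measure_iUnion_le _) _))
    _ ≤ T * 2⁻¹ + ∑' m, T * c m := by
        gcongr with m
        exact measure_lt_enorm_le_of_eLpNorm_le
          (hg.indicator (measurableSet_annulus n _)) hq (h m)
    _ ≤ T * 2⁻¹ + T * 2⁻¹ := by
        rw [ENNReal.tsum_mul_left]
        gcongr
    _ = T := by rw [← mul_add, ENNReal.inv_two_add_inv_two, mul_one]

theorem rearrangement_ballVolume_le_iSup (hn : n ≠ 0) {q : ℝ≥0∞} (hq : q ≠ 0)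
    {g : EuclideanSpace ℝ (Fin n) → 𝕜} (hg : AEStronglyMeasurable g volume) {c : ℕ → ℝ≥0∞}
    (hc : ∑' m, c m ≤ 2⁻¹) (hc₀ : ∀ m, c m ≠ 0) (hc' : ∀ m, c m ≠ ∞) (i : ℤ) :
    rearrangement g (ballVolume n i) ≤ ⨆ m : ℕ,
      (ENNReal.ofReal (ballVolume n i) * c m) ^ (-(q⁻¹).toReal) *
        eLpNorm ((annulus n (i + m)).indicator g) q volume := by
  refine rearrangement_ballVolume_le hn hq hg hc fun m => ?_
  have ht : ENNReal.ofReal (ballVolume n i) * c m ≠ 0 :=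
    mul_ne_zero (ENNReal.ofReal_pos.2 (ballVolume_pos n i)).ne' (hc₀ m)
  have ht' : ENNReal.ofReal (ballVolume n i) * c m ≠ ∞ :=
    ENNReal.mul_ne_top ENNReal.ofReal_ne_top (hc' m)
  refine le_trans (le_of_eq ?_) (mul_le_mul_right (le_iSup _ m) _)
  rw [← mul_assoc, ← ENNReal.rpow_add _ _ ht ht', add_neg_cancel, ENNReal.rpow_zero, one_mul]

theorem tsum_sub_div_two_mul_pow {η : ℝ≥0∞} (hη : η < 1) :
    ∑' m : ℕ, (1 - η) / 2 * η ^ m = 2⁻¹ := by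
  rw [ENNReal.tsum_mul_left, ENNReal.tsum_geometric, mul_comm, div_eq_mul_inv, ← mul_assoc,
    ENNReal.inv_mul_cancel (tsub_pos_of_lt hη).ne' (by finiteness), one_mul]

/-- The ratio `2 ^ (-a)` of the shares satisfies `2 ^ (-a) = 2 ^ (-s) * (2 ^ (-a)) ^ (-y)`, so
that the weight `2 ^ ((i + m) * s)` of the annulus `i + m` comes with a decaying factor. -/
theorem ballVolume_rpow_mul_share_rpow {s p y a : ℝ} (hs : s = n * (1 / p - y))
    (has : s = a * (y + 1)) {κ : ℝ≥0∞} (hκ : κ ≠ ∞) (i : ℤ) (m : ℕ) :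
    ENNReal.ofReal (ballVolume n i) ^ (1 / p) *
        (ENNReal.ofReal (ballVolume n i) * (κ * (2 ^ (-a)) ^ m)) ^ (-y) =
      ENNReal.ofReal (ballVolume n 0) ^ (1 / p - y) * κ ^ (-y) *
        ((2 ^ (-a)) ^ m * 2 ^ ((i + m : ℤ) * s)) := by
  set T := ENNReal.ofReal (ballVolume n i)
  have hT : T ^ (1 / p) * T ^ (-y) =
      ENNReal.ofReal (ballVolume n 0) ^ (1 / p - y) * 2 ^ (i * s) := by
    rw [← ENNReal.rpow_add _ _ (ENNReal.ofReal_pos.2 (ballVolume_pos n i)).ne'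
      ENNReal.ofReal_ne_top, ← sub_eq_add_neg, ofReal_ballVolume_rpow, hs]
  have hpow : (2 : ℝ≥0∞) ^ (i * s) * ((2 ^ (-a)) ^ m) ^ (-y) =
      (2 ^ (-a)) ^ m * 2 ^ ((i + m : ℤ) * s) := by
    simp only [← ENNReal.rpow_mul_natCast, ← ENNReal.rpow_mul,
      ← ENNReal.rpow_add _ _ two_ne_zero ENNReal.ofNat_ne_top]
    rw [has]
    push_cast
    ring_nf
  rw [ENNReal.mul_rpow_of_ne_top ENNReal.ofReal_ne_top (by finiteness),
    ENNReal.mul_rpow_of_ne_top hκ (by finiteness), ← mul_assoc, hT, ← hpow]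
  ring

theorem exists_meshTerm_le (hn : n ≠ 0) {s p : ℝ} {q : ℝ≥0∞} (hq : q ≠ 0)
    (hs : s = n * (1 / p - (q⁻¹).toReal)) (hs₀ : 0 < s) :
    ∃ C : ℝ≥0, ∃ ρ : ℝ≥0∞, ρ < 1 ∧ ∀ g : EuclideanSpace ℝ (Fin n) → 𝕜,
      AEStronglyMeasurable g volume → ∀ i : ℤ,
        meshTerm p g i ≤ C * ⨆ m : ℕ, ρ ^ m * annulusTerm s q g (i + m) := by
  set y := (q⁻¹).toReal
  have hy : 0 ≤ y := ENNReal.toReal_nonneg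
  obtain ⟨a, ha, has⟩ : ∃ a, 0 < a ∧ s = a * (y + 1) := ⟨s / (y + 1), by positivity, by field_simp⟩
  have hη : (2 : ℝ≥0∞) ^ (-a) < 1 :=
    ENNReal.rpow_lt_one_of_one_lt_of_neg ENNReal.one_lt_two (neg_neg_of_pos ha)
  let κ : ℝ≥0∞ := (1 - 2 ^ (-a)) / 2
  have hκ : κ ≠ 0 := (ENNReal.div_pos (tsub_pos_of_lt hη).ne' ENNReal.ofNat_ne_top).ne'
  have hκ' : κ ≠ ∞ := by finiteness
  have hC : ENNReal.ofReal (ballVolume n 0) ^ (1 / p - y) * κ ^ (-y) ≠ ∞ :=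
    ENNReal.mul_ne_top (ENNReal.rpow_ne_top_of_ne_zero
      (ENNReal.ofReal_pos.2 (ballVolume_pos n 0)).ne' ENNReal.ofReal_ne_top)
      (ENNReal.rpow_ne_top_of_ne_zero hκ hκ')
  refine ⟨(ENNReal.ofReal (ballVolume n 0) ^ (1 / p - y) * κ ^ (-y)).toNNReal, 2 ^ (-a), hη,
    fun g hg i => ?_⟩
  rw [ENNReal.coe_toNNReal hC]
  let N (m : ℕ) : ℝ≥0∞ := eLpNorm ((annulus n (i + m)).indicator g) q volume
  calc meshTerm p g i
      ≤ ENNReal.ofReal (ballVolume n i) ^ (1 / p) *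
          ⨆ m, (ENNReal.ofReal (ballVolume n i) * (κ * (2 ^ (-a)) ^ m)) ^ (-y) * N m := by
        rw [meshTerm]
        gcongr
        exact rearrangement_ballVolume_le_iSup hn hq hg (tsum_sub_div_two_mul_pow hη).le
          (fun m => mul_ne_zero hκ (by simp)) (fun m => by finiteness) i
    _ = _ := by
        simp only [ENNReal.mul_iSup]
        refine iSup_congr fun m => ?_
        rw [← mul_assoc, ballVolume_rpow_mul_share_rpow hs has hκ', annulusTerm]
        ring

theorem exists_lorentzNorm_le_herzNorm (hn : n ≠ 0) {s p : ℝ} (hp : 0 < p) {q r : ℝ≥0∞}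
    (hq : q ≠ 0) (hr : r ≠ 0) (hs : s = n * (1 / p - (q⁻¹).toReal)) (hs₀ : 0 < s) :
    ∃ C : ℝ≥0, ∀ g : EuclideanSpace ℝ (Fin n) → 𝕜, AEStronglyMeasurable g volume →
      lorentzNorm p r g ≤ C * herzNorm s q r g := by
  obtain ⟨A, hA⟩ := exists_lorentzNorm_le_eLpNorm_meshTerm (𝕜 := 𝕜) hn hp.le hr
  obtain ⟨B, ρ, hρ, hB⟩ := exists_meshTerm_le (𝕜 := 𝕜) hn hq hs hs₀
  obtain ⟨C, hC⟩ := exists_eLpNorm_iSup_pow_mul_le hr hρ fun m : ℕ => Equiv.addRight (m : ℤ)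
  refine ⟨A * (B * C), fun g hg => ?_⟩
  calc lorentzNorm p r g ≤ A * eLpNorm (meshTerm p g) r .count := hA g
    _ ≤ A * (B * (C * eLpNorm (annulusTerm s q g) r .count)) := by
        gcongr
        exact (eLpNorm_count_le_mul (hB g hg) r).trans (by gcongr; exact hC (annulusTerm s q g))
    _ = (A * (B * C) : ℝ≥0) * herzNorm s q r g := by
        rw [herzNorm_eq_eLpNorm hr]
        push_cast
        ring

end HerzToLorentz

end HerzLorentz

theorem proposition5p1 {𝕜 : Type*} [RCLike 𝕜] (n : ℕ) (hn : 1 ≤ n) (s st : ℝ)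
    (p : ℝ) (hp : 0 < p) (q r : ℝ≥0∞) (hq : 0 < q) (hr : 0 < r)
    (hexp : s / n + (q⁻¹).toReal = st / n + 1 / p) :
    (s < st → ∃ C : ℝ≥0, ∀ f : EuclideanSpace ℝ (Fin n) → 𝕜,
      HerzLorentz.MemWeightedLorentz st p r f →
        HerzLorentz.MemHerz s q r f ∧
          HerzLorentz.herzNorm s q r f ≤ C * HerzLorentz.weightedLorentzNorm st p r f) ∧
    (st < s → ∃ C : ℝ≥0, ∀ f : EuclideanSpace ℝ (Fin n) → 𝕜,
      HerzLorentz.MemHerz s q r f →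
        HerzLorentz.MemWeightedLorentz st p r f ∧
          HerzLorentz.weightedLorentzNorm st p r f ≤ C * HerzLorentz.herzNorm s q r f) := by
  have hn₀ : n ≠ 0 := Nat.one_le_iff_ne_zero.1 hn
  have hs : s - st = n * (1 / p - (q⁻¹).toReal) := by
    field_simp at hexp ⊢
    linarith
  refine ⟨fun hlt => ?_, fun hlt => ?_⟩
  · obtain ⟨C, hC⟩ := HerzLorentz.exists_herzNorm_le_lorentzNorm (𝕜 := 𝕜) hn₀ hp hq.ne' hr.ne' hs
      (sub_neg.2 hlt)
    refine ⟨2 ^ |st| * C, fun f ⟨hf, hfin⟩ => ?_⟩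
    have hle : HerzLorentz.herzNorm s q r f ≤
        (2 ^ |st| * C : ℝ≥0) * HerzLorentz.weightedLorentzNorm st p r f := by
      rw [ENNReal.coe_mul, mul_assoc]
      exact (HerzLorentz.herzNorm_le_powerWeight s st q hr.ne' f).trans (by gcongr; exact hC _)
    exact ⟨⟨hf, hle.trans_lt (ENNReal.mul_lt_top ENNReal.coe_lt_top hfin)⟩, hle⟩
  · obtain ⟨C, hC⟩ := HerzLorentz.exists_lorentzNorm_le_herzNorm (𝕜 := 𝕜) hn₀ hp hq.ne' hr.ne' hs
      (sub_pos.2 hlt)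
    refine ⟨C * 2 ^ |st|, fun f ⟨hf, hfin⟩ => ?_⟩
    have hle : HerzLorentz.weightedLorentzNorm st p r f ≤
        (C * 2 ^ |st| : ℝ≥0) * HerzLorentz.herzNorm s q r f := by
      rw [ENNReal.coe_mul, mul_assoc]
      exact (hC _ (HerzLorentz.aestronglyMeasurable_powerWeight hf st)).trans
        (by gcongr; exact HerzLorentz.herzNorm_powerWeight_le s st q hr.ne' f)
    exact ⟨⟨hf, hle.trans_lt (ENNReal.mul_lt_top ENNReal.coe_lt_top hfin)⟩, hle⟩
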